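/- Let $E$ be an Archimedean real vector lattice. Let $E^{\sim}$ be its order dual (the linear functionals that are bounded on order intervals, ordered by $\varphi\le\psi$ iff $\varphi(x)\le\psi(x)$ for all $x\ge 0$; this is a vector lattice), and let $E^{\sim}_{oc}\subseteq E^{\sim}$ be its order continuous dual. Let $I$ be an ideal (solid linear subspace) of $E^{\sim}_{oc}$ that separates the points of $E$. Terminology. A net $(x_\alpha)$ in $E$ is order convergent to $x$ if there is a net $(y_\beta)$ in $E$, possibly with another index set, with $y_\beta\downarrow 0$ and such that for each $\beta_0$ there is an $\alpha_0$ with $|x_\alpha-x|\le y_{\beta_0}$ for all $\alpha\ge\alpha_0$. It is unbounded order (uo-) convergent to $x$ if $|x_\alpha-x|\wedge|y|$ is order convergent to $0$ for every $y\in E$. The space $E$ has the countable sup property if every subset of $E$ that has a supremum in $E$ contains an at most countable subset with the same supremum. The weak topology $\sigma(E,I)$ is the coarsest topology on $E$ for which all $\varphi\in I$ are continuous. The absolute weak topology $|\sigma|(E,I)$ is generated by the seminorms $x\mapsto|\varphi|(|x|)$, $\varphi\in I$. The topology $\tau:=\mathrm{u}|\sigma|(E,I)$ is the linear topology on $E$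 for which the sets $\{x:|x|\wedge|y|\in V\}$, with $y\in E$ and $V$ a solid $|\sigma|(E,I)$-neighbourhood of zero, form a neighbourhood basis at zero. The carrier $C_\tau$ is the union of the disjoint complements $N^{\mathrm d}$ of all sets $N=\bigcap_{n} V_n$, where $(V_n)_{n\ge1}$ is a sequence of solid $\tau$-neighbourhoods of zero with $V_{n+1}+V_{n+1}\subseteq V_n$ for all $n$. A countable order basis of $C_\tau$ is a non-empty, at most countable subset of $C_\tau$ such that only $0\in C_\tau$ is disjoint from all its elements. Then: 1. $C_\tau=E$ if and only if $E$ has the countable sup property. 2. If $C_\tau$ has a countable order basis, then $C_\tau=E$. 3. If $\tau$ is metrisable, then $C_\tau=E$. 4. If $E$ has the countable sup property (equivalently, $C_\tau=E$), then for every convex subset $S$ of $E$ and every $x$ in the $\sigma(E,I)$-closure of $S$, there is a sequence in $S$ that is uo-convergent to $x$ in $E$. -/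

import Mathlib

open Set Filter Topology

namespace VectorLattice

universe u

/-! Throughout, a (real) vector lattice is a type `E` with the instances
`[AddCommGroup E] [Lattice E] [IsOrderedAddMonoid E] [Module ℝ E] [IsOrderedModule ℝ E]`. -/

/-! ### Order-theoretic notions in a vector lattice -/

section Basic

variable {E : Type u} [AddCommGroup E] [Lattice E]

/-- `E` is Archimedean: whenever `x` and `y ≥ 0` satisfy `n x ≤ y` for all `n`, then `x ≤ 0`.
(Mathlib's class `Archimedean` asks for something else, namely that every strictly positive
element is an order unit.) -/
def IsArchimedean (E : Type u) [AddCommGroup E] [Lattice E] : Prop :=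
  ∀ x y : E, 0 ≤ y → (∀ n : ℕ, n • x ≤ y) → x ≤ 0

/-- The net `(x a)_{a ∈ A}` is order convergent to `x₀`: there is a net `(y b)_{b ∈ B}`, possibly
with another index set, such that `y ↓ 0` and every `y b` eventually dominates `|x a - x₀|`.
(Index sets `B` in the universe of `E` suffice: `y` may be replaced by its range, which is a
downward directed subset of `E`.) -/
def OrderConverges {A : Type*} [Preorder A] (x : A → E) (x₀ : E) : Prop :=
  ∃ (B : Type u) (_ : Preorder B) (_ : Nonempty B) (_ : IsDirected B (· ≤ ·)) (y : B → E),
    Antitone y ∧ IsGLB (range y) 0 ∧ ∀ b₀, ∃ a₀, ∀ a, a₀ ≤ a → |x a - x₀| ≤ y b₀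

/-- Unbounded order convergence. -/
def UOConverges {A : Type*} [Preorder A] (x : A → E) (x₀ : E) : Prop :=
  ∀ y : E, OrderConverges (fun a => |x a - x₀| ⊓ |y|) 0

/-- The countable sup property. -/
def CountableSupProperty (E : Type u) [Lattice E] : Prop :=
  ∀ (D : Set E) (s : E), IsLUB D s → ∃ D' ⊆ D, D'.Countable ∧ IsLUB D' s

/-- The disjoint complement of a set. -/
def disjointCompl (N : Set E) : Set E := {x | ∀ z ∈ N, |x| ⊓ |z| = 0}

/-- The ideal `F` of `E` (given by its underlying set), considered as a vector lattice in its own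
right, has an (at most) countable order basis: a countable non-empty subset `A` whose disjoint
complement in `F` is zero. -/
def HasCountableOrderBasis (F : Set E) : Prop :=
  ∃ A ⊆ F, A.Nonempty ∧ A.Countable ∧ F ∩ disjointCompl A = {0}

end Basic

/-! ### The order dual and the order continuous dual -/

section Dual

variable (E : Type u) [AddCommGroup E] [Lattice E] [Module ℝ E]

/-- The order dual of `E`: the linear functionals that are bounded on order intervals. -/
def orderDual : Submodule ℝ (E →ₗ[ℝ] ℝ) where
  carrier := {φ | ∀ a b : E, ∃ C : ℝ, ∀ x ∈ Icc a b, |φ x| ≤ C}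
  add_mem' := by
    intro φ ψ hφ hψ a b
    obtain ⟨C, hC⟩ := hφ a b
    obtain ⟨D, hD⟩ := hψ a b
    exact ⟨C + D, fun x hx => (abs_add_le _ _).trans (add_le_add (hC x hx) (hD x hx))⟩
  zero_mem' := fun a b => ⟨0, fun x _ => by simp⟩
  smul_mem' := by
    intro c φ hφ a b
    obtain ⟨C, hC⟩ := hφ a b
    refine ⟨|c| * C, fun x hx => ?_⟩
    rw [LinearMap.smul_apply, smul_eq_mul, abs_mul]
    exact mul_le_mul_of_nonneg_left (hC x hx) (abs_nonneg c)

variable {E}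

/-- The Riesz-Kantorovich formula for the positive part of an order bounded functional, on the
positive cone. -/
noncomputable def posFun (φ : orderDual E) (x : E) : ℝ := sSup (φ.1 '' Icc 0 x)

theorem bddAbove_posFun (φ : orderDual E) (x : E) : BddAbove (φ.1 '' Icc 0 x) := by
  obtain ⟨C, hC⟩ := φ.2 0 x
  refine ⟨C, ?_⟩
  rintro _ ⟨z, hz, rfl⟩
  exact (le_abs_self _).trans (hC z hz)

theorem le_posFun (φ : orderDual E) {x z : E} (h0 : 0 ≤ z) (hz : z ≤ x) : φ.1 z ≤ posFun φ x :=
  le_csSup (bddAbove_posFun φ x) ⟨z, ⟨h0, hz⟩, rfl⟩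

theorem posFun_le (φ : orderDual E) {x : E} (hx : 0 ≤ x) {c : ℝ}
    (h : ∀ z, 0 ≤ z → z ≤ x → φ.1 z ≤ c) : posFun φ x ≤ c := by
  refine csSup_le ⟨_, 0, ⟨le_rfl, hx⟩, rfl⟩ ?_
  rintro _ ⟨z, hz, rfl⟩
  exact h z hz.1 hz.2

theorem posFun_nonneg (φ : orderDual E) {x : E} (hx : 0 ≤ x) : 0 ≤ posFun φ x := by
  simpa using le_posFun φ le_rfl hx

variable [IsOrderedAddMonoid E]

theorem posFun_add (φ : orderDual E) {x y : E} (hx : 0 ≤ x) (hy : 0 ≤ y) :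
    posFun φ (x + y) = posFun φ x + posFun φ y := by
  apply le_antisymm
  · refine posFun_le φ (add_nonneg hx hy) fun z hz hzxy => ?_
    have h1 : φ.1 z = φ.1 (z ⊓ x) + φ.1 (z - z ⊓ x) := by rw [← map_add]; congr 1; abel
    rw [h1]
    refine add_le_add (le_posFun φ (le_inf hz hx) inf_le_right)
      (le_posFun φ (sub_nonneg.2 inf_le_left) ?_)
    rw [sub_le_iff_le_add, ← sub_le_iff_le_add']
    exact le_inf (sub_le_self _ hy) (sub_le_iff_le_add.2 hzxy)
  · rw [← le_sub_iff_add_le]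
    refine posFun_le φ hx fun z hz hzx => ?_
    rw [le_sub_iff_add_le, ← le_sub_iff_add_le']
    refine posFun_le φ hy fun w hw hwy => ?_
    rw [le_sub_iff_add_le', ← map_add]
    exact le_posFun φ (add_nonneg hz hw) (add_le_add hzx hwy)

variable [IsOrderedModule ℝ E]

theorem posFun_smul_le (φ : orderDual E) {c : ℝ} (hc : 0 < c) {x : E} (hx : 0 ≤ x) :
    posFun φ (c • x) ≤ c * posFun φ x := by
  refine posFun_le φ (smul_nonneg hc.le hx) fun z hz hzx => ?_
  have h1 : z = c • (c⁻¹ • z) := by rw [smul_smul, mul_inv_cancel₀ hc.ne', one_smul]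
  rw [h1, map_smul, smul_eq_mul]
  refine mul_le_mul_of_nonneg_left (le_posFun φ (smul_nonneg (inv_nonneg.2 hc.le) hz) ?_) hc.le
  have h2 := smul_le_smul_of_nonneg_left hzx (inv_nonneg.2 hc.le)
  rwa [smul_smul, inv_mul_cancel₀ hc.ne', one_smul] at h2

theorem posFun_smul (φ : orderDual E) {c : ℝ} (hc : 0 ≤ c) {x : E} (hx : 0 ≤ x) :
    posFun φ (c • x) = c * posFun φ x := by
  rcases hc.eq_or_lt with rfl | hc
  · rw [zero_smul, zero_mul]
    exact le_antisymm (posFun_le φ le_rfl fun z h1 h2 => by simp [le_antisymm h2 h1])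
      (posFun_nonneg φ le_rfl)
  · refine le_antisymm (posFun_smul_le φ hc hx) ?_
    have h := posFun_smul_le φ (inv_pos.2 hc) (smul_nonneg hc.le hx)
    rw [smul_smul, inv_mul_cancel₀ hc.ne', one_smul] at h
    calc c * posFun φ x ≤ c * (c⁻¹ * posFun φ (c • x)) := mul_le_mul_of_nonneg_left h hc.le
      _ = posFun φ (c • x) := by rw [← mul_assoc, mul_inv_cancel₀ hc.ne', one_mul]

theorem posFun_sub_eq (φ : orderDual E) {x a b : E} (ha : 0 ≤ a) (hb : 0 ≤ b) (h : x = a - b) :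
    posFun φ (x⁺) - posFun φ (x⁻) = posFun φ a - posFun φ b := by
  have h1 : x⁺ + b = a + x⁻ := by
    have h2 := posPart_sub_negPart x
    rw [sub_eq_iff_eq_add] at h2
    rw [h2, h]; abel
  have h3 := posFun_add φ (posPart_nonneg x) hb
  have h4 := posFun_add φ ha (negPart_nonneg x)
  rw [h1] at h3
  linarith

/-- The positive part of an order bounded functional. -/
noncomputable def posPartDual (φ : orderDual E) : orderDual E where
  val :=
    { toFun := fun x => posFun φ (x⁺) - posFun φ (x⁻)
      map_add' := by
        intro x y
        rw [posFun_sub_eq φ (add_nonneg (posPart_nonneg x) (posPart_nonneg y))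
          (add_nonneg (negPart_nonneg x) (negPart_nonneg y)),
          posFun_add φ (posPart_nonneg x) (posPart_nonneg y),
          posFun_add φ (negPart_nonneg x) (negPart_nonneg y)]
        · ring
        · conv_lhs => rw [← posPart_sub_negPart x, ← posPart_sub_negPart y]
          abel
      map_smul' := by
        intro c x
        simp only [RingHom.id_apply, smul_eq_mul]
        rcases le_total 0 c with hc | hc
        · rw [posFun_sub_eq φ (smul_nonneg hc (posPart_nonneg x))
            (smul_nonneg hc (negPart_nonneg x)), posFun_smul φ hc (posPart_nonneg x),
            posFun_smul φ hc (negPart_nonneg x)]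
          · ring
          · rw [← smul_sub, posPart_sub_negPart]
        · have hc' : 0 ≤ -c := neg_nonneg.2 hc
          rw [posFun_sub_eq φ (smul_nonneg hc' (negPart_nonneg x))
            (smul_nonneg hc' (posPart_nonneg x)), posFun_smul φ hc' (posPart_nonneg x),
            posFun_smul φ hc' (negPart_nonneg x)]
          · ring
          · rw [← smul_sub, neg_smul, ← smul_neg, neg_sub, posPart_sub_negPart] }
  property := by
    intro a b
    refine ⟨posFun φ (b⁺) + posFun φ (a⁻), fun x hx => ?_⟩
    have hmono : ∀ {s t : E}, 0 ≤ s → s ≤ t → posFun φ s ≤ posFun φ t := fun {s t} hs hst =>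
      posFun_le φ hs fun z hz hzs => le_posFun φ hz (hzs.trans hst)
    have h1 := hmono (posPart_nonneg x) (posPart_mono hx.2)
    have h2 := hmono (negPart_nonneg x) (negPart_anti hx.1)
    have h3 := posFun_nonneg φ (posPart_nonneg x)
    have h4 := posFun_nonneg φ (negPart_nonneg x)
    have h5 := posFun_nonneg φ (posPart_nonneg b)
    have h6 := posFun_nonneg φ (negPart_nonneg a)
    change |posFun φ (x⁺) - posFun φ (x⁻)| ≤ _
    rw [abs_le]
    constructor <;> linarith

theorem posPartDual_apply (φ : orderDual E) {x : E} (hx : 0 ≤ x) :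
    (posPartDual φ).1 x = posFun φ x := by
  change posFun φ (x⁺) - posFun φ (x⁻) = _
  rw [posFun_sub_eq φ hx le_rfl (sub_zero x).symm]
  have : posFun φ (0 : E) = 0 :=
    le_antisymm (posFun_le φ le_rfl fun z h1 h2 => by simp [le_antisymm h2 h1])
      (posFun_nonneg φ le_rfl)
  rw [this, sub_zero]

/-- The usual order on the order dual: `φ ≤ ψ` if `φ x ≤ ψ x` for all `x ≥ 0`. -/
instance instPartialOrderOrderDual : PartialOrder (orderDual E) where
  le φ ψ := ∀ x : E, 0 ≤ x → φ.1 x ≤ ψ.1 x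
  le_refl φ x _ := le_rfl
  le_trans φ ψ χ h1 h2 x hx := (h1 x hx).trans (h2 x hx)
  le_antisymm φ ψ h1 h2 := by
    apply Subtype.ext
    apply LinearMap.ext
    intro x
    have h3 := le_antisymm (h1 _ (posPart_nonneg x)) (h2 _ (posPart_nonneg x))
    have h4 := le_antisymm (h1 _ (negPart_nonneg x)) (h2 _ (negPart_nonneg x))
    rw [← posPart_sub_negPart x, map_sub, map_sub, h3, h4]

theorem posPartDual_isLUB (φ : orderDual E) : IsLUB {φ, 0} (posPartDual φ) := by
  constructor
  · rintro ψ (rfl | rfl)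
    · intro x hx
      rw [posPartDual_apply _ hx]
      exact le_posFun _ hx le_rfl
    · intro x hx
      rw [posPartDual_apply _ hx]
      exact posFun_nonneg φ hx
  · intro ψ hψ x hx
    have h1 : φ ≤ ψ := hψ (by simp)
    have h2 : (0 : orderDual E) ≤ ψ := hψ (by simp)
    rw [posPartDual_apply _ hx]
    refine posFun_le φ hx fun z hz hzx => (h1 z hz).trans ?_
    have h3 := h2 (x - z) (sub_nonneg.2 hzx)
    simp only [map_sub] at h3
    simpa using h3

instance instIsOrderedAddMonoidOrderDual : IsOrderedAddMonoid (orderDual E) where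
  add_le_add_left φ ψ h χ := fun x hx => by
    have := h x hx
    change φ.1 x + χ.1 x ≤ ψ.1 x + χ.1 x
    linarith

/-- The order dual is a vector lattice; in particular `|φ| = φ ⊔ -φ` makes sense in it. -/
noncomputable instance instLatticeOrderDual : Lattice (orderDual E) where
  sup φ ψ := posPartDual (φ - ψ) + ψ
  le_sup_left φ ψ := sub_le_iff_le_add.1 ((posPartDual_isLUB (φ - ψ)).1 (by simp))
  le_sup_right φ ψ := le_add_of_nonneg_left ((posPartDual_isLUB (φ - ψ)).1 (by simp))
  sup_le φ ψ χ h1 h2 := le_sub_iff_add_le.1 ((posPartDual_isLUB (φ - ψ)).2 (by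
    rintro _ (rfl | rfl)
    · exact sub_le_sub_right h1 ψ
    · exact sub_nonneg.2 h2))
  inf φ ψ := φ - posPartDual (φ - ψ)
  inf_le_left φ ψ := sub_le_self _ ((posPartDual_isLUB (φ - ψ)).1 (by simp))
  inf_le_right φ ψ := sub_le_comm.1 ((posPartDual_isLUB (φ - ψ)).1 (by simp))
  le_inf φ ψ χ h1 h2 := le_sub_comm.1 ((posPartDual_isLUB (ψ - χ)).2 (by
    rintro _ (rfl | rfl)
    · exact sub_le_sub_left h2 ψ
    · exact sub_nonneg.2 h1))

variable (E) in
/-- The order continuous dual of `E`: the order bounded functionals that map nets that are order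
convergent to zero to nets that converge to zero. -/
def orderContDual : Submodule ℝ (orderDual E) where
  carrier := {φ | ∀ (A : Type u) [Preorder A] [Nonempty A] [IsDirected A (· ≤ ·)] (x : A → E),
    OrderConverges x 0 → Tendsto (fun a => φ.1 (x a)) atTop (𝓝 0)}
  add_mem' := by
    intro φ ψ hφ hψ A _ _ _ x hx
    simpa using (hφ A x hx).add (hψ A x hx)
  zero_mem' := by
    intro A _ _ _ x hx
    simp
  smul_mem' := by
    intro c φ hφ A _ _ _ x hx
    simpa using (hφ A x hx).const_mul c

/-- `I` is an ideal in the order continuous dual: a solid linear subspace of it. -/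
def IsIdealInOrderContDual (I : Submodule ℝ (orderDual E)) : Prop :=
  I ≤ orderContDual E ∧ ∀ φ ∈ orderContDual E, ∀ ψ ∈ I, |φ| ≤ |ψ| → φ ∈ I

end Dual

/-! ### Topologies -/

section Topologies

variable {E : Type u} [AddCommGroup E] [Lattice E]

/-- `V` is a solid (not necessarily open) neighbourhood of zero for the topology `τ`. -/
def IsSolidNhdZero (τ : TopologicalSpace E) (V : Set E) : Prop :=
  LatticeOrderedAddCommGroup.IsSolid V ∧ V ∈ @nhds E τ 0

/-- The carrier of `τ`: the union of the disjoint complements of all sets `⋂ₙ Vₙ`, where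
`(Vₙ)` is a normal sequence of solid `τ`-neighbourhoods of zero. -/
def carrier (τ : TopologicalSpace E) : Set E :=
  {x | ∃ V : ℕ → Set E, (∀ n, IsSolidNhdZero τ (V n)) ∧
    (∀ n, ∀ y ∈ V (n + 1), ∀ z ∈ V (n + 1), y + z ∈ V n) ∧ x ∈ disjointCompl (⋂ n, V n)}

variable [IsOrderedAddMonoid E]

/-- The unbounded topology generated by a (locally solid) topology `τ` on `E`. Its neighbourhoods
of zero have as a basis the sets `{z | |z| ⊓ |y| ∈ V}`, where `V` is a solid `τ`-neighbourhood
of zero and `y ∈ E`; those of a general point are translates. -/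
def unboundedTopology (τ : TopologicalSpace E) : TopologicalSpace E where
  IsOpen U := ∀ x ∈ U, ∃ V, IsSolidNhdZero τ V ∧ ∃ y : E, ∀ z : E, |z| ⊓ |y| ∈ V → x + z ∈ U
  isOpen_univ := fun _ _ => ⟨univ, ⟨fun _ _ _ _ => trivial, univ_mem⟩, 0, fun _ _ => trivial⟩
  isOpen_inter := by
    rintro U₁ U₂ h₁ h₂ x ⟨hx₁, hx₂⟩
    obtain ⟨V₁, hV₁, y₁, hy₁⟩ := h₁ x hx₁
    obtain ⟨V₂, hV₂, y₂, hy₂⟩ := h₂ x hx₂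
    have key : ∀ z y : E, |y| ≤ |y₁| ⊔ |y₂| → abs (|z| ⊓ |y|) ≤ abs (|z| ⊓ abs (|y₁| ⊔ |y₂|)) := by
      intro z y hy
      have h0 : 0 ≤ |y₁| ⊔ |y₂| := (abs_nonneg y₁).trans le_sup_left
      rw [abs_of_nonneg h0, abs_of_nonneg (le_inf (abs_nonneg z) (abs_nonneg y)),
        abs_of_nonneg (le_inf (abs_nonneg z) h0)]
      exact inf_le_inf le_rfl hy
    refine ⟨V₁ ∩ V₂, ⟨fun a ha b hb => ⟨hV₁.1 ha.1 hb, hV₂.1 ha.2 hb⟩,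
      inter_mem hV₁.2 hV₂.2⟩, |y₁| ⊔ |y₂|, fun z hz => ⟨hy₁ z ?_, hy₂ z ?_⟩⟩
    · exact hV₁.1 hz.1 (key z y₁ le_sup_left)
    · exact hV₂.1 hz.2 (key z y₂ le_sup_right)
  isOpen_sUnion := by
    rintro S hS x ⟨U, hU, hx⟩
    obtain ⟨V, hV, y, hy⟩ := hS U hU x hx
    exact ⟨V, hV, y, fun z hz => ⟨U, hU, hy z hz⟩⟩

variable [Module ℝ E] [IsOrderedModule ℝ E]

theorem abs_smul_of_nonneg {c : ℝ} (hc : 0 ≤ c) (x : E) : |c • x| = c • |x| := by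
  rcases hc.eq_or_lt with rfl | hc
  · simp
  · apply le_antisymm
    · exact abs_le'.2 ⟨smul_le_smul_of_nonneg_left (le_abs_self x) hc.le, by
        rw [← smul_neg]; exact smul_le_smul_of_nonneg_left (neg_le_abs x) hc.le⟩
    · have h : |x| ≤ c⁻¹ • |c • x| := by
        have key : ∀ w : E, w ≤ |c • x| → c⁻¹ • w ≤ c⁻¹ • |c • x| := fun w hw =>
          smul_le_smul_of_nonneg_left hw (inv_nonneg.2 hc.le)
        refine abs_le'.2 ⟨?_, ?_⟩
        · simpa [smul_smul, inv_mul_cancel₀ hc.ne'] using key _ (le_abs_self (c • x))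
        · simpa [smul_smul, inv_mul_cancel₀ hc.ne'] using key _ (neg_le_abs (c • x))
      have h2 := smul_le_smul_of_nonneg_left h hc.le
      rwa [smul_smul, mul_inv_cancel₀ hc.ne', one_smul] at h2

theorem abs_dual_mono (φ : orderDual E) {x y : E} (hxy : x ≤ y) : (|φ|).1 x ≤ (|φ|).1 y := by
  have h := abs_nonneg φ (y - x) (sub_nonneg.2 hxy)
  simp only [map_sub] at h
  simpa using h

/-- The lattice seminorm `x ↦ |φ|(|x|)`. -/
noncomputable def absSeminorm (φ : orderDual E) : Seminorm ℝ E :=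
  Seminorm.of (fun x => (|φ|).1 |x|)
    (fun x y => by
      rw [← map_add]
      exact abs_dual_mono φ (abs_add_le x y))
    (fun c x => by
      have h : |c • x| = |c| • |x| := by
        rcases le_total 0 c with hc | hc
        · rw [abs_of_nonneg hc]
          exact abs_smul_of_nonneg hc x
        · rw [abs_of_nonpos hc, ← abs_neg (c • x), ← neg_smul]
          exact abs_smul_of_nonneg (neg_nonneg.2 hc) x
      rw [h, map_smul, smul_eq_mul, Real.norm_eq_abs])

/-- The absolute weak topology `|σ|(E, I)`, generated by the seminorms `x ↦ |φ|(|x|)`, `φ ∈ I`. -/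
noncomputable def absWeakTopology (I : Submodule ℝ (orderDual E)) : TopologicalSpace E :=
  (SeminormFamily.moduleFilterBasis (fun φ : I => absSeminorm φ.1)).topology

/-- The weak topology `σ(E, I)`: the coarsest topology for which all `φ ∈ I` are continuous. -/
def weakTopology (I : Submodule ℝ (orderDual E)) : TopologicalSpace E :=
  ⨅ φ ∈ I, TopologicalSpace.induced (fun x => φ.1 x) inferInstance

end Topologies

end VectorLattice

namespace VectorLattice

universe u

set_option linter.unusedSectionVars false

/-! ### Disjointness and Archimedean density in lattice-ordered groups -/

section LatticeGroup

variable {E : Type u} [AddCommGroup E] [Lattice E] [IsOrderedAddMonoid E]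

/-! The carrier is translated into functionals. Since `I` is an ideal, a single condition `φ (|z| ⊓
y) < ε` with positive `φ ∈ I` describes a basic neighbourhood of zero, so `x` lies in the carrier
iff some sequence of positive members of `I` is faithful on `|x|` (`mem_carrier_iff`).

If `E` has the countable sup property, such a sequence comes from writing `|x|` as a countable
supremum of elements disjoint from the null ideal of some functional; `isLUB_nullCompl` supplies
these by order continuity and the Archimedean property. Conversely, a faithful sequence detects when
countably many finite suprema exhaust a given supremum. A countable order basis or a countable base
at zero yields one sequence that is faithful everywhere.

For convex sets, Hahn–Banach together with solidity of `I` replaces weak closeness by smallness of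
`φ |s - x|`. A diagonal choice makes `|s n - x|` geometrically small along functionals faithful on
every earlier `|s m - x|`. An element below all eventual upper bounds of `|s n - x| ⊓ y` is then
disjoint from every `|s m - x|`, and the Archimedean property excludes a positive one
(`orderConverges_inf_of_isFaithfulOn`). -/

theorem add_inf_le_inf_add_inf {a b y : E} (ha : 0 ≤ a) (hb : 0 ≤ b) (hy : 0 ≤ y) :
    (a + b) ⊓ y ≤ a ⊓ y + b ⊓ y := by
  rw [inf_add, add_inf, add_inf]
  refine le_inf (le_inf inf_le_left ?_) (le_inf ?_ ?_)
  · exact inf_le_right.trans (le_add_of_nonneg_left ha)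
  · exact inf_le_right.trans (le_add_of_nonneg_right hb)
  · exact inf_le_right.trans (le_add_of_nonneg_left hy)

theorem abs_add_inf_le (a b : E) {y : E} (hy : 0 ≤ y) :
    |a + b| ⊓ y ≤ |a| ⊓ y + |b| ⊓ y :=
  (inf_le_inf_right y (abs_add_le a b)).trans
    (add_inf_le_inf_add_inf (abs_nonneg a) (abs_nonneg b) hy)

theorem add_eq_sup_of_inf_eq_zero {a b : E} (h : a ⊓ b = 0) : a + b = a ⊔ b := by
  rw [← inf_add_sup a b, h, zero_add]

theorem add_le_of_inf_eq_zero {a b y : E} (h : a ⊓ b = 0) (ha : a ≤ y) (hb : b ≤ y) :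
    a + b ≤ y := by
  rw [add_eq_sup_of_inf_eq_zero h]
  exact sup_le ha hb

theorem inf_nsmul_eq_zero {a b : E} (ha : 0 ≤ a) (hb : 0 ≤ b) (h : a ⊓ b = 0) (n : ℕ) :
    a ⊓ n • b = 0 := by
  induction n with
  | zero => simpa using ha
  | succ n ih =>
    refine le_antisymm ?_ (le_inf ha (nsmul_nonneg hb _))
    rw [inf_comm, succ_nsmul]
    refine (add_inf_le_inf_add_inf (nsmul_nonneg hb n) hb ha).trans ?_
    rw [inf_comm, ih, inf_comm, h, add_zero]

/-- An element `≤ x` that is disjoint from a set of positive elements with supremum `x` is zero. -/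
theorem eq_zero_of_isLUB_of_disjoint {D : Set E} {x z : E} (hD : IsLUB D x) (hz : 0 ≤ z)
    (hzx : z ≤ x) (h : ∀ d ∈ D, d ⊓ z = 0) : z = 0 := by
  refine le_antisymm ?_ hz
  have : x ≤ x - z :=
    hD.2 fun d hd => le_sub_iff_add_le.2 (add_le_of_inf_eq_zero (h d hd) (hD.1 hd) hzx)
  simpa using this

/-- In an Archimedean vector lattice, if the additively closed set `A` meets every interval
`(0, z]` with `0 < z ≤ x`, then `x` is the supremum of the elements of `A` in `[0, x]`. -/
theorem IsArchimedean.isLUB_of_dense (hE : IsArchimedean E) {A : Set E} (h0 : 0 ∈ A)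
    (hadd : ∀ a ∈ A, ∀ b ∈ A, 0 ≤ a → 0 ≤ b → a + b ∈ A) {x : E} (hx : 0 ≤ x)
    (hdense : ∀ z, 0 ≤ z → z ≠ 0 → z ≤ x → ∃ w ∈ A, 0 ≤ w ∧ w ≠ 0 ∧ w ≤ z) :
    IsLUB (A ∩ Icc 0 x) x := by
  refine ⟨fun d hd => hd.2.2, fun u hu => ?_⟩
  by_contra hxu
  have hu0 : 0 ≤ u := hu ⟨h0, le_rfl, hx⟩
  -- An upper bound `u` not above `x` leaves a non-zero gap containing some `w ∈ A`. Any multiple of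
  -- `w` in `A ∩ Icc 0 x` is below `x ⊓ u`, so adding another `w` stays below `x`; this never stops,
  -- contradicting the Archimedean property.
  obtain ⟨w, hwA, hw0, hwne, hw⟩ := hdense (x - x ⊓ u) (sub_nonneg.2 inf_le_left)
    (fun h => hxu (by rw [sub_eq_zero.1 h]; exact inf_le_right))
    (sub_le_self _ (le_inf hx hu0))
  have key : ∀ n : ℕ, n • w ∈ A ∩ Icc 0 x := by
    intro n
    induction n with
    | zero => simpa using ⟨h0, hx⟩
    | succ n ih =>
      rw [succ_nsmul]
      refine ⟨hadd _ ih.1 _ hwA ih.2.1 hw0, add_nonneg ih.2.1 hw0, ?_⟩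
      calc n • w + w ≤ x ⊓ u + (x - x ⊓ u) := add_le_add (le_inf ih.2.2 (hu ih)) hw
        _ = x := by abel
  exact hwne (le_antisymm (hE w x hx fun n => (key n).2.2) hw0)

end LatticeGroup

/-! ### Order continuity of positive parts and moduli -/

section OrderContinuity

variable {E : Type u} [AddCommGroup E] [Lattice E] [IsOrderedAddMonoid E] [Module ℝ E]

theorem dual_mono {φ : orderDual E} (hφ : 0 ≤ φ) {x y : E} (h : x ≤ y) : φ.1 x ≤ φ.1 y := by
  have h := hφ (y - x) (sub_nonneg.2 h)
  simp only [map_sub] at h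
  simpa using h

theorem dual_nonneg {φ : orderDual E} (hφ : 0 ≤ φ) {x : E} (h : 0 ≤ x) : 0 ≤ φ.1 x := by
  simpa using dual_mono hφ h

theorem OrderConverges.of_antitone {A : Type u} [Preorder A] [Nonempty A]
    [IsDirected A (· ≤ ·)] {x : A → E} (hx : Antitone x) (hglb : IsGLB (range x) 0) :
    OrderConverges x 0 := by
  refine ⟨A, inferInstance, inferInstance, inferInstance, x, hx, hglb, fun b => ⟨b, fun a hab => ?_⟩⟩
  rw [sub_zero, abs_of_nonneg (hglb.1 ⟨a, rfl⟩)]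
  exact hx hab

variable [IsOrderedModule ℝ E]

/-- A functional dominated by a positive functional that is continuous along nets decreasing
to zero is order continuous. -/
theorem mem_orderContDual_of_abs_le {φ ψ : orderDual E} (h : ∀ x, |φ.1 x| ≤ ψ.1 |x|)
    (hpos : 0 ≤ ψ)
    (hψ : ∀ (A : Type u) [Preorder A] [Nonempty A] [IsDirected A (· ≤ ·)] (x : A → E),
      Antitone x → IsGLB (range x) 0 → ∀ ε > 0, ∃ a, ψ.1 (x a) < ε) :
    φ ∈ orderContDual E := by
  rintro A _ _ _ x ⟨B, _, _, _, y, hy, hglb, hxy⟩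
  rw [Metric.tendsto_nhds]
  intro ε hε
  obtain ⟨b, hb⟩ := hψ B y hy hglb ε hε
  obtain ⟨a₀, ha₀⟩ := hxy b
  filter_upwards [eventually_ge_atTop a₀] with a ha
  rw [Real.dist_eq, sub_zero]
  have h1 := ha₀ a ha
  rw [sub_zero] at h1
  exact ((h _).trans (dual_mono hpos h1)).trans_lt hb

theorem posPartDual_nonneg (φ : orderDual E) : 0 ≤ posPartDual φ :=
  (posPartDual_isLUB φ).1 (by simp)

/-- Choose `y ∈ Icc 0 (x a₀)` at which `φ` nearly attains the positive part of `φ` at `x a₀`. As `y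
- y ⊓ x a` lies in `Icc 0 (x a₀ - x a)`, additivity bounds the positive part at `x a` by `φ (y ⊓ x
a) + ε / 2`, and the first term tends to zero. -/
theorem exists_posPartDual_lt {φ : orderDual E} (hφ : φ ∈ orderContDual E) {A : Type u}
    [Preorder A] [Nonempty A] [IsDirected A (· ≤ ·)] {x : A → E} (hx : Antitone x)
    (hglb : IsGLB (range x) 0) {ε : ℝ} (hε : 0 < ε) : ∃ a, (posPartDual φ).1 (x a) < ε := by
  have hx0 : ∀ a, 0 ≤ x a := fun a => hglb.1 ⟨a, rfl⟩
  obtain ⟨a₀⟩ := ‹Nonempty A›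
  obtain ⟨_, ⟨y, hy, rfl⟩, hlt⟩ := exists_lt_of_lt_csSup
    (s := φ.1 '' Icc 0 (x a₀)) ⟨_, 0, ⟨le_rfl, hx0 a₀⟩, rfl⟩
    (show posFun φ (x a₀) - ε / 2 < posFun φ (x a₀) by linarith)
  have hanti : Antitone fun a => y ⊓ x a := fun a b hab => inf_le_inf_left y (hx hab)
  have hglb' : IsGLB (range fun a => y ⊓ x a) 0 := by
    refine ⟨?_, fun c hc => hglb.2 ?_⟩
    · rintro _ ⟨a, rfl⟩
      exact le_inf hy.1 (hx0 a)
    · rintro _ ⟨a, rfl⟩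
      exact (hc ⟨a, rfl⟩).trans inf_le_right
  have hA : Nonempty A := ⟨a₀⟩
  have htends := hφ A _ (OrderConverges.of_antitone hanti hglb')
  obtain ⟨a₁, ha₁⟩ := (htends.eventually (gt_mem_nhds (half_pos hε))).exists_forall_of_atTop
  obtain ⟨a, h0, h1⟩ := exists_ge_ge a₀ a₁
  refine ⟨a, ?_⟩
  have h2 := ha₁ a h1
  have h3 : φ.1 (y - y ⊓ x a) ≤ posFun φ (x a₀ - x a) := by
    refine le_posFun φ (sub_nonneg.2 inf_le_left) ?_
    rw [sub_le_iff_le_add, ← sub_le_iff_le_add']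
    refine le_inf (sub_le_self _ (sub_nonneg.2 (hx h0))) ?_
    rw [sub_le_iff_le_add]
    simpa using hy.2
  have h4 : posFun φ (x a₀ - x a) = posFun φ (x a₀) - posFun φ (x a) := by
    have := posFun_add φ (sub_nonneg.2 (hx h0)) (hx0 a)
    rw [sub_add_cancel] at this
    linarith
  rw [posPartDual_apply φ (hx0 a)]
  rw [map_sub] at h3
  linarith

theorem posPartDual_mem_orderContDual {φ : orderDual E} (hφ : φ ∈ orderContDual E) :
    posPartDual φ ∈ orderContDual E := by
  refine mem_orderContDual_of_abs_le (fun x => ?_) (posPartDual_nonneg φ)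
    fun A _ _ _ x hx hglb ε hε => exists_posPartDual_lt hφ hx hglb hε
  refine abs_le'.2 ⟨dual_mono (posPartDual_nonneg φ) (le_abs_self x), ?_⟩
  rw [← map_neg]
  exact dual_mono (posPartDual_nonneg φ) (neg_le_abs x)

theorem abs_eq_posPartDual_add (φ : orderDual E) : |φ| = posPartDual φ + posPartDual (-φ) := by
  rw [← posPart_add_negPart φ]
  -- By definition `ψ ⊔ 0` is `posPartDual (ψ - 0) + 0`.
  have h : ∀ ψ : orderDual E, ψ ⊔ 0 = posPartDual ψ := fun ψ =>
    (add_zero (posPartDual (ψ - 0))).trans (congrArg posPartDual (sub_zero ψ))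
  rw [posPart_def, negPart_def, h, h]

theorem abs_mem_orderContDual {φ : orderDual E} (hφ : φ ∈ orderContDual E) :
    |φ| ∈ orderContDual E := by
  rw [abs_eq_posPartDual_add]
  refine add_mem (posPartDual_mem_orderContDual hφ) (posPartDual_mem_orderContDual ?_)
  have h : (-1 : ℝ) • φ = -φ := Subtype.ext (LinearMap.ext fun x => by simp)
  rw [← h]
  exact (orderContDual E).smul_mem (-1 : ℝ) hφ

theorem abs_apply_le (φ : orderDual E) (x : E) : |φ.1 x| ≤ (|φ|).1 |x| := by
  have h1 := le_abs_self φ _ (posPart_nonneg x)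
  have h2 := le_abs_self φ _ (negPart_nonneg x)
  have h3 : -φ.1 x⁺ ≤ (|φ|).1 x⁺ := neg_le_abs φ _ (posPart_nonneg x)
  have h4 : -φ.1 x⁻ ≤ (|φ|).1 x⁻ := neg_le_abs φ _ (negPart_nonneg x)
  have h5 : φ.1 x = φ.1 x⁺ - φ.1 x⁻ := by rw [← map_sub, posPart_sub_negPart]
  have h6 : (|φ|).1 |x| = (|φ|).1 x⁺ + (|φ|).1 x⁻ := by rw [← map_add, posPart_add_negPart]
  rw [h5, h6, abs_le]
  constructor <;> linarith

theorem abs_le_of_abs_apply_le {φ ψ : orderDual E} (h : ∀ x, |φ.1 x| ≤ ψ.1 |x|) : |φ| ≤ ψ := by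
  refine abs_le'.2 ⟨fun x hx => ?_, fun x hx => ?_⟩
  · have := (le_abs_self _).trans (h x)
    rwa [abs_of_nonneg hx] at this
  · have := (neg_le_abs _).trans (h x)
    rwa [abs_of_nonneg hx] at this

/-- A positive order continuous functional takes small values on a set directed downwards
to zero. -/
theorem exists_apply_lt {φ : orderDual E} (hφ : φ ∈ orderContDual E)
    {D : Set E} (hne : D.Nonempty) (hdir : DirectedOn (· ≥ ·) D) (hD : IsGLB D 0) {ε : ℝ}
    (hε : 0 < ε) : ∃ d ∈ D, φ.1 d < ε := by
  have : Nonempty (D)ᵒᵈ := hne.to_subtype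
  have : IsDirected (D)ᵒᵈ (· ≤ ·) := ⟨fun a b => by
    obtain ⟨c, hc, h1, h2⟩ := hdir _ (OrderDual.ofDual a).2 _ (OrderDual.ofDual b).2
    exact ⟨OrderDual.toDual ⟨c, hc⟩, h1, h2⟩⟩
  have hanti : Antitone fun a : (D)ᵒᵈ => (OrderDual.ofDual (α := D) a).1 := fun a b hab => hab
  have hrange : range (fun a : (D)ᵒᵈ => (OrderDual.ofDual (α := D) a).1) = D := Subtype.range_coe
  have h := hφ _ _ (OrderConverges.of_antitone hanti (by rwa [hrange]))
  obtain ⟨a, ha⟩ := (h.eventually (gt_mem_nhds hε)).exists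
  exact ⟨_, (OrderDual.ofDual a).2, ha⟩

/-- Ideals are closed under domination by positive elements. -/
theorem IsIdealInOrderContDual.mem_of_abs_apply_le {I : Submodule ℝ (orderDual E)}
    (hI : IsIdealInOrderContDual I) {φ ψ : orderDual E} (hψ : ψ ∈ I)
    (h : ∀ x, |φ.1 x| ≤ ψ.1 |x|) : φ ∈ I := by
  have h0 : (0 : orderDual E) ≤ ψ := (abs_nonneg φ).trans (abs_le_of_abs_apply_le h)
  refine hI.2 φ ?_ ψ hψ ((abs_le_of_abs_apply_le h).trans (le_abs_self ψ))
  refine mem_orderContDual_of_abs_le h h0 fun A _ _ _ x hx hglb ε hε => ?_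
  obtain ⟨a, ha⟩ := ((hI.1 hψ A x (OrderConverges.of_antitone hx hglb)).eventually
    (gt_mem_nhds hε)).exists
  exact ⟨a, ha⟩

theorem IsIdealInOrderContDual.abs_mem {I : Submodule ℝ (orderDual E)}
    (hI : IsIdealInOrderContDual I) {φ : orderDual E} (hφ : φ ∈ I) : |φ| ∈ I :=
  hI.2 _ (abs_mem_orderContDual (hI.1 hφ)) φ hφ (abs_abs φ).le

end OrderContinuity

/-! ### Neighbourhoods of zero given by a single functional -/

section Neighbourhoods

variable {E : Type u} [AddCommGroup E] [Lattice E] [IsOrderedAddMonoid E] [Module ℝ E]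
  [IsOrderedModule ℝ E] {I : Submodule ℝ (orderDual E)}

theorem absSeminorm_apply (φ : orderDual E) (x : E) : absSeminorm φ x = (|φ|).1 |x| := rfl

theorem absSeminorm_apply_of_nonneg {φ : orderDual E} (hφ : 0 ≤ φ) (x : E) :
    absSeminorm φ x = φ.1 |x| := by
  rw [absSeminorm_apply, abs_of_nonneg hφ]

theorem sum_apply {ι : Type*} (s : Finset ι) (φ : ι → orderDual E) (x : E) :
    (∑ i ∈ s, φ i).1 x = ∑ i ∈ s, (φ i).1 x := by
  induction s using Finset.cons_induction with
  | empty => simp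
  | cons i s hi ih => rw [Finset.sum_cons, Finset.sum_cons, ← ih]; rfl

theorem sum_dual_nonneg {ι : Type*} (s : Finset ι) {φ : ι → orderDual E}
    (h : ∀ i ∈ s, 0 ≤ φ i) : 0 ≤ ∑ i ∈ s, φ i := Finset.sum_nonneg h

/-- Finitely many seminorms are dominated by the one coming from the sum of the moduli, which stays
in `I`. -/
theorem mem_nhds_absWeakTopology_iff (hI : IsIdealInOrderContDual I) {V : Set E} :
    V ∈ @nhds E (absWeakTopology I) 0 ↔
      ∃ φ ∈ I, 0 ≤ φ ∧ ∃ ε > 0, ∀ z, φ.1 |z| < ε → z ∈ V := by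
  let _ : TopologicalSpace E := absWeakTopology I
  have hws : WithSeminorms (fun φ : I => absSeminorm φ.1) := ⟨rfl⟩
  change V ∈ 𝓝 0 ↔ _
  rw [hws.mem_nhds_iff]
  constructor
  · rintro ⟨s, r, hr, hV⟩
    refine ⟨∑ φ ∈ s, |φ.1|, I.sum_mem fun φ _ => hI.abs_mem φ.2,
      sum_dual_nonneg s fun φ _ => abs_nonneg φ.1, r, hr, fun z hz => hV ?_⟩
    rw [Seminorm.mem_ball_zero]
    refine Seminorm.finset_sup_apply_lt hr fun φ hφ => lt_of_le_of_lt ?_ hz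
    rw [sum_apply]
    exact Finset.single_le_sum (f := fun φ : I => (|φ.1|).1 |z|)
      (fun ψ _ => dual_nonneg (abs_nonneg ψ.1) (abs_nonneg z)) hφ
  · rintro ⟨φ, hφ, h0, ε, hε, hV⟩
    refine ⟨{⟨φ, hφ⟩}, ε, hε, fun z hz => hV z ?_⟩
    rw [Finset.sup_singleton, Seminorm.mem_ball_zero, absSeminorm_apply_of_nonneg h0] at hz
    exact hz

theorem mem_nhds_unboundedTopology_iff (hI : IsIdealInOrderContDual I) {V : Set E} :
    V ∈ @nhds E (unboundedTopology (absWeakTopology I)) 0 ↔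
      ∃ φ ∈ I, 0 ≤ φ ∧ ∃ y, 0 ≤ y ∧ ∃ ε > 0, ∀ z, φ.1 (|z| ⊓ y) < ε → z ∈ V := by
  rw [@mem_nhds_iff E (x := 0) (s := V) (unboundedTopology (absWeakTopology I))]
  constructor
  · rintro ⟨U, hUV, hU, h0⟩
    obtain ⟨W, ⟨-, hW⟩, y, hy⟩ := hU 0 h0
    obtain ⟨φ, hφ, hφ0, ε, hε, hφW⟩ := (mem_nhds_absWeakTopology_iff hI).1 hW
    refine ⟨φ, hφ, hφ0, |y|, abs_nonneg y, ε, hε, fun z hz => hUV ?_⟩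
    rw [← zero_add z]
    refine hy z (hφW _ ?_)
    rwa [abs_of_nonneg (le_inf (abs_nonneg z) (abs_nonneg y))]
  · rintro ⟨φ, hφ, h0, y, hy, ε, hε, hV⟩
    refine ⟨{z | φ.1 (|z| ⊓ y) < ε}, hV, fun x hx => ?_, ?_⟩
    -- The radius is the slack left at `x`; subadditivity of `z ↦ φ (|z| ⊓ y)` makes the set open.
    · refine ⟨{z | φ.1 |z| < ε - φ.1 (|x| ⊓ y)}, ⟨fun a ha b hb => ?_,
        (mem_nhds_absWeakTopology_iff hI).2 ⟨φ, hφ, h0, _, sub_pos.2 hx, fun z hz => hz⟩⟩, y,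
        fun z hz => ?_⟩
      · exact (dual_mono h0 hb).trans_lt ha
      · rw [abs_of_nonneg hy] at hz
        have hz' : φ.1 |(|z| ⊓ y)| < ε - φ.1 (|x| ⊓ y) := hz
        rw [abs_of_nonneg (le_inf (abs_nonneg z) hy)] at hz'
        have := dual_mono h0 (abs_add_inf_le x z hy)
        rw [map_add] at this
        change φ.1 (|x + z| ⊓ y) < ε
        linarith
    · change φ.1 (|(0 : E)| ⊓ y) < ε
      rwa [abs_zero, inf_eq_left.2 hy, map_zero]

end Neighbourhoods

/-! ### The carrier and the countable sup property -/

section Carrier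

variable {E : Type u} [AddCommGroup E] [Lattice E] [IsOrderedAddMonoid E] [Module ℝ E]
  [IsOrderedModule ℝ E] {I : Submodule ℝ (orderDual E)}

/-- The only element of `[0, x]` annihilated by all `φ n` is zero. -/
def IsFaithfulOn (φ : ℕ → orderDual E) (x : E) : Prop :=
  ∀ z, 0 ≤ z → z ≤ x → (∀ n, (φ n).1 z = 0) → z = 0

/-- Testing ever more functionals on `|z| ⊓ |x|` with halving bounds gives a normal sequence. All `φ
k` vanish at `|z| ⊓ |x|` for `z` in its intersection, so faithfulness makes `z` disjoint from `x`.
-/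
theorem mem_carrier_of_isFaithfulOn (hI : IsIdealInOrderContDual I) {φ : ℕ → orderDual E} {x : E}
    (hφI : ∀ n, φ n ∈ I) (hφ0 : ∀ n, 0 ≤ φ n) (hφ : IsFaithfulOn φ |x|) :
    x ∈ carrier (unboundedTopology (absWeakTopology I)) := by
  have hx0 := abs_nonneg x
  have hp : ∀ n, 0 ≤ ∑ k ∈ Finset.range n, φ k :=
    fun n => sum_dual_nonneg _ fun k _ => hφ0 k
  have hpn : ∀ k z, 0 ≤ (φ k).1 (|z| ⊓ |x|) := fun k z =>
    dual_nonneg (hφ0 k) (le_inf (abs_nonneg z) hx0)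
  refine ⟨fun n => {z | (∑ k ∈ Finset.range n, φ k).1 (|z| ⊓ |x|) < (1 / 2 : ℝ) ^ n},
    fun n => ⟨fun a ha b hb => ?_, ?_⟩, fun n y hy z hz => ?_, fun z hz => ?_⟩
  · exact (dual_mono (hp n) (inf_le_inf_right _ hb)).trans_lt ha
  · exact (mem_nhds_unboundedTopology_iff hI).2 ⟨_, I.sum_mem fun k _ => hφI k, hp n, _, hx0, _,
      by positivity, fun z hz => hz⟩
  · simp only [mem_ofPred_eq] at hy hz ⊢
    have h1 := dual_mono (hp n) (abs_add_inf_le y z hx0)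
    rw [map_add] at h1
    simp only [sum_apply] at hy hz h1 ⊢
    rw [Finset.sum_range_succ] at hy hz
    have h2 := hpn n y
    have h3 := hpn n z
    rw [pow_succ] at hy hz
    linarith
  · rw [inf_comm]
    refine hφ _ (le_inf (abs_nonneg z) hx0) inf_le_right fun k => le_antisymm ?_ (hpn k z)
    refine ge_of_tendsto (tendsto_pow_atTop_nhds_zero_of_lt_one (r := (1 / 2 : ℝ))
      (by norm_num) (by norm_num)) ?_
    filter_upwards [eventually_gt_atTop k] with n hn
    have h1 := mem_iInter.1 hz n
    simp only [mem_ofPred_eq, sum_apply] at h1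
    exact (Finset.single_le_sum (f := fun k => (φ k).1 (|z| ⊓ |x|)) (fun k _ => hpn k z)
      (Finset.mem_range.2 hn)).trans h1.le

/-- Take one functional from a basic neighbourhood inside each `V n`. An element of `Icc 0 |x|`
killed by all of them lies in every `V n`, hence is disjoint from `x` and therefore zero. -/
theorem exists_isFaithfulOn_of_mem_carrier (hI : IsIdealInOrderContDual I) {x : E}
    (hx : x ∈ carrier (unboundedTopology (absWeakTopology I))) :
    ∃ φ : ℕ → orderDual E, (∀ n, φ n ∈ I) ∧ (∀ n, 0 ≤ φ n) ∧ IsFaithfulOn φ |x| := by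
  obtain ⟨V, hV, -, hdisj⟩ := hx
  choose φ hφI hφ0 y hy ε hε hφV using
    fun n => (mem_nhds_unboundedTopology_iff hI).1 (hV n).2
  refine ⟨φ, hφI, hφ0, fun z hz hzx h => ?_⟩
  have h1 := hdisj z (mem_iInter.2 fun n => hφV n z ?_)
  · rwa [abs_of_nonneg hz, inf_eq_right.2 hzx] at h1
  · rw [abs_of_nonneg hz]
    exact ((dual_mono (hφ0 n) inf_le_left).trans_eq (h n)).trans_lt (hε n)

theorem mem_carrier_iff (hI : IsIdealInOrderContDual I) {x : E} :
    x ∈ carrier (unboundedTopology (absWeakTopology I)) ↔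
      ∃ φ : ℕ → orderDual E, (∀ n, φ n ∈ I) ∧ (∀ n, 0 ≤ φ n) ∧ IsFaithfulOn φ |x| :=
  ⟨exists_isFaithfulOn_of_mem_carrier hI,
    fun ⟨_, h1, h2, h3⟩ => mem_carrier_of_isFaithfulOn hI h1 h2 h3⟩

theorem exists_apply_pos (hI : IsIdealInOrderContDual I)
    (hsep : ∀ x y : E, x ≠ y → ∃ φ ∈ I, φ.1 x ≠ φ.1 y) {z : E} (hz : 0 ≤ z) (hne : z ≠ 0) :
    ∃ φ ∈ I, 0 ≤ φ ∧ 0 < φ.1 z := by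
  obtain ⟨φ, hφ, h⟩ := hsep z 0 hne
  rw [map_zero] at h
  refine ⟨|φ|, hI.abs_mem hφ, abs_nonneg φ, (abs_pos.2 h).trans_le ?_⟩
  simpa [abs_of_nonneg hz] using abs_apply_le φ z

/-- If the positive order continuous functional `φ` is not zero at `z ≥ 0`, there is a non-zero
`w ∈ [0, z]` disjoint from the null ideal of `φ`. -/
theorem exists_disjoint_null (hE : IsArchimedean E) {φ : orderDual E} (hφ : φ ∈ orderContDual E)
    (h0 : 0 ≤ φ) {z : E} (hz : 0 ≤ z) (hpos : 0 < φ.1 z) :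
    ∃ w, 0 ≤ w ∧ w ≠ 0 ∧ w ≤ z ∧ ∀ v, 0 ≤ v → φ.1 v = 0 → w ⊓ v = 0 := by
  by_contra! hcon
  have hmono : ∀ {a b : E}, 0 ≤ a → a ≤ b → φ.1 b = 0 → φ.1 a = 0 := fun ha hab hb =>
    le_antisymm ((dual_mono h0 hab).trans_eq hb) (dual_nonneg h0 ha)
  have hadd : ∀ a ∈ {a | φ.1 a = 0}, ∀ b ∈ {a | φ.1 a = 0}, 0 ≤ a → 0 ≤ b →
      a + b ∈ {a | φ.1 a = 0} := by
    intro a ha b hb _ _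
    rw [mem_ofPred_eq] at ha hb ⊢
    rw [map_add, ha, hb, add_zero]
  -- If no such `w` exists, null elements occur below every non-zero element of `Icc 0 z`, so `z` is
  -- a supremum of null elements. Order continuity then forces `φ z = 0`.
  have hlub := hE.isLUB_of_dense (A := {a | φ.1 a = 0}) (map_zero _) hadd hz
    fun w hw hwne hwz => by
      obtain ⟨v, hv, hφv, hne⟩ := hcon w hw hwne hwz
      exact ⟨w ⊓ v, hmono (le_inf hw hv) inf_le_right hφv, le_inf hw hv, hne, inf_le_left⟩
  obtain ⟨_, ⟨a, ha, rfl⟩, hlt⟩ := exists_apply_lt hφ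
    (D := (fun a => z - a) '' ({a | φ.1 a = 0} ∩ Icc 0 z)) ⟨_, 0, ⟨map_zero _, le_rfl, hz⟩, rfl⟩
    (by
      rintro _ ⟨a, ha, rfl⟩ _ ⟨b, hb, rfl⟩
      refine ⟨_, ⟨a ⊔ b, ⟨?_, ha.2.1.trans le_sup_left, sup_le ha.2.2 hb.2.2⟩, rfl⟩,
        sub_le_sub_left le_sup_left z, sub_le_sub_left le_sup_right z⟩
      exact hmono (ha.2.1.trans le_sup_left) (sup_le (le_add_of_nonneg_right hb.2.1)
        (le_add_of_nonneg_left ha.2.1)) (hadd a ha.1 b hb.1 ha.2.1 hb.2.1))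
    (by
      refine ⟨?_, fun c hc => ?_⟩
      · rintro _ ⟨a, ha, rfl⟩
        exact sub_nonneg.2 ha.2.2
      · have : z ≤ z - c := hlub.2 fun a ha => le_sub_comm.1 (hc ⟨a, ha, rfl⟩)
        simpa using this) hpos
  have ha' : φ.1 a = 0 := ha.1
  simp only [map_sub, ha', sub_zero, lt_irrefl] at hlt

/-- The elements disjoint from the null ideal of some positive `φ ∈ I`. -/
def nullCompl (I : Submodule ℝ (orderDual E)) : Set E :=
  {w | ∃ φ ∈ I, 0 ≤ φ ∧ ∀ v, 0 ≤ v → φ.1 v = 0 → w ⊓ v = 0}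

theorem exists_mem_nullCompl (hE : IsArchimedean E) (hI : IsIdealInOrderContDual I)
    (hsep : ∀ x y : E, x ≠ y → ∃ φ ∈ I, φ.1 x ≠ φ.1 y) {z : E} (hz : 0 ≤ z) (hne : z ≠ 0) :
    ∃ w ∈ nullCompl I, 0 ≤ w ∧ w ≠ 0 ∧ w ≤ z := by
  obtain ⟨φ, hφI, hφ0, hpos⟩ := exists_apply_pos hI hsep hz hne
  obtain ⟨w, h1, h2, h3, h4⟩ := exists_disjoint_null hE (hI.1 hφI) hφ0 hz hpos
  exact ⟨w, ⟨φ, hφI, hφ0, h4⟩, h1, h2, h3⟩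

theorem mem_carrier_of_mem_nullCompl (hI : IsIdealInOrderContDual I) {w : E} (hw0 : 0 ≤ w)
    (hw : w ∈ nullCompl I) : w ∈ carrier (unboundedTopology (absWeakTopology I)) := by
  obtain ⟨φ, hφI, hφ0, h⟩ := hw
  refine mem_carrier_of_isFaithfulOn hI (fun _ : ℕ => hφI) (fun _ => hφ0) fun z hz hzw hφz => ?_
  rw [abs_of_nonneg hw0] at hzw
  rw [← h z hz (hφz 0), inf_eq_right.2 hzw]

/-- Density holds because `I` separates points. Closure under sums holds because a positive element
null for `φ + ψ` is null for both `φ` and `ψ`. -/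
theorem isLUB_nullCompl (hE : IsArchimedean E) (hI : IsIdealInOrderContDual I)
    (hsep : ∀ x y : E, x ≠ y → ∃ φ ∈ I, φ.1 x ≠ φ.1 y) {x : E} (hx : 0 ≤ x) :
    IsLUB (nullCompl I ∩ Icc 0 x) x := by
  refine hE.isLUB_of_dense (A := nullCompl I) ⟨0, I.zero_mem, le_rfl, fun v hv _ => inf_eq_left.2 hv⟩ ?_ hx
    fun z hz hne _ => exists_mem_nullCompl hE hI hsep hz hne
  rintro a ⟨φ, hφI, hφ0, hφ⟩ b ⟨ψ, hψI, hψ0, hψ⟩ ha hb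
  refine ⟨φ + ψ, I.add_mem hφI hψI, add_nonneg hφ0 hψ0, fun v hv h => ?_⟩
  have h1 := dual_nonneg hφ0 hv
  have h2 := dual_nonneg hψ0 hv
  have h3 : φ.1 v + ψ.1 v = 0 := h
  refine le_antisymm ((add_inf_le_inf_add_inf ha hb hv).trans_eq ?_) (le_inf (add_nonneg ha hb) hv)
  rw [hφ v hv (by linarith), hψ v hv (by linarith), add_zero]

theorem carrier_eq_univ_of_countableSup (hE : IsArchimedean E) (hI : IsIdealInOrderContDual I)
    (hsep : ∀ x y : E, x ≠ y → ∃ φ ∈ I, φ.1 x ≠ φ.1 y) (hc : CountableSupProperty E) :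
    carrier (unboundedTopology (absWeakTopology I)) = univ := by
  refine eq_univ_of_forall fun x => (mem_carrier_iff hI).2 ?_
  obtain ⟨D, hD, hcount, hlub⟩ := hc _ _ (isLUB_nullCompl hE hI hsep (abs_nonneg x))
  rcases D.eq_empty_or_nonempty with rfl | hne
  · refine ⟨fun _ => 0, fun _ => I.zero_mem, fun _ => le_rfl, fun z hz hzx _ => ?_⟩
    exact eq_zero_of_isLUB_of_disjoint hlub hz hzx (by simp)
  obtain ⟨d, rfl⟩ := hcount.exists_eq_range hne
  choose φ hφI hφ0 hφ using fun n => (hD ⟨n, rfl⟩).1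
  exact ⟨φ, hφI, hφ0, fun z hz hzx h => eq_zero_of_isLUB_of_disjoint hlub hz hzx (by
    rintro _ ⟨n, rfl⟩
    exact hφ n z hz (h n))⟩

/-- The gaps between `s` and finite suprema from `D` decrease to zero, so order continuity makes
each functional of a faithful sequence as small as desired on some gap. The countably many finite
sets used already have supremum `s`. -/
theorem countableSup_of_carrier_eq_univ (hI : IsIdealInOrderContDual I)
    (hC : carrier (unboundedTopology (absWeakTopology I)) = univ) : CountableSupProperty E := by
  classical
  intro D s hD
  rcases D.eq_empty_or_nonempty with rfl | ⟨d₀, hd₀⟩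
  · exact ⟨∅, subset_rfl, countable_empty, hD⟩
  obtain ⟨φ, hφI, hφ0, hφ⟩ := (mem_carrier_iff hI).1 (hC ▸ mem_univ (s - d₀))
  rw [abs_of_nonneg (sub_nonneg.2 (hD.1 hd₀))] at hφ
  let G : Set E := {g | ∃ F : Finset E, (F : Set E) ⊆ D ∧ ∃ h : F.Nonempty, g = s - F.sup' h id}
  have hGne : G.Nonempty := ⟨_, {d₀}, by simpa using hd₀, Finset.singleton_nonempty d₀, rfl⟩
  have hGdir : DirectedOn (· ≥ ·) G := by
    rintro _ ⟨F, hF, hFne, rfl⟩ _ ⟨F', hF', hFne', rfl⟩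
    refine ⟨_, ⟨F ∪ F', by simpa using ⟨hF, hF'⟩, hFne.mono Finset.subset_union_left, rfl⟩,
      sub_le_sub_left (Finset.sup'_mono _ Finset.subset_union_left _) s,
      sub_le_sub_left (Finset.sup'_mono _ Finset.subset_union_right _) s⟩
  have hGglb : IsGLB G 0 := by
    refine ⟨?_, fun c hc => ?_⟩
    · rintro _ ⟨F, hF, hFne, rfl⟩
      exact sub_nonneg.2 (Finset.sup'_le _ _ fun d hd => hD.1 (hF hd))
    · have : s ≤ s - c := hD.2 fun d hd => le_sub_comm.1
        (hc ⟨{d}, by simpa using hd, Finset.singleton_nonempty d, by simp⟩)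
      simpa using this
  have hex : ∀ p : ℕ × ℕ, ∃ F : Finset E, (F : Set E) ⊆ D ∧ ∃ h : F.Nonempty,
      (φ p.1).1 (s - F.sup' h id) < 1 / ((p.2 : ℝ) + 1) := fun p => by
    obtain ⟨_, ⟨F, hF, hne, rfl⟩, hlt⟩ :=
      exists_apply_lt (hI.1 (hφI p.1)) hGne hGdir hGglb (ε := 1 / ((p.2 : ℝ) + 1))
        (by positivity)
    exact ⟨F, hF, hne, hlt⟩
  choose F hF hFne hlt using hex
  -- Including `d₀` keeps `s - s ⊓ u` below `s - d₀`, where the sequence is faithful.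
  refine ⟨insert d₀ (⋃ p, (F p : Set E)), insert_subset hd₀ (iUnion_subset hF),
    (countable_iUnion fun p => (F p).countable_toSet).insert d₀, ?_, fun u hu => ?_⟩
  · rintro d (rfl | hd)
    · exact hD.1 hd₀
    · obtain ⟨p, hp⟩ := mem_iUnion.1 hd
      exact hD.1 (hF p hp)
  · have hz0 : 0 ≤ s - s ⊓ u := sub_nonneg.2 inf_le_left
    have h := hφ (s - s ⊓ u) hz0
      (sub_le_sub_left (le_inf (hD.1 hd₀) (hu (mem_insert _ _))) s) fun n => by
        refine le_antisymm ?_ (dual_nonneg (hφ0 n) hz0)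
        refine ge_of_tendsto' tendsto_one_div_add_atTop_nhds_zero_nat fun m => ?_
        refine (dual_mono (hφ0 n) (sub_le_sub_left (Finset.sup'_le _ _ fun d hd => ?_) s)).trans
          (hlt (n, m)).le
        have hd' : d ∈ insert d₀ (⋃ p, (F p : Set E)) := mem_insert_of_mem _ (mem_iUnion.2 ⟨_, hd⟩)
        exact le_inf (hD.1 (hF _ hd)) (hu hd')
    rw [sub_eq_zero.1 h]
    exact inf_le_right

/-- Merge the faithful sequences of all basis elements into one. A positive element killed by it is
disjoint from the basis; were it non-zero, it would dominate a non-zero carrier element with the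
same property. -/
theorem carrier_eq_univ_of_hasCountableOrderBasis (hE : IsArchimedean E)
    (hI : IsIdealInOrderContDual I) (hsep : ∀ x y : E, x ≠ y → ∃ φ ∈ I, φ.1 x ≠ φ.1 y)
    (hb : HasCountableOrderBasis (carrier (unboundedTopology (absWeakTopology I)))) :
    carrier (unboundedTopology (absWeakTopology I)) = univ := by
  obtain ⟨A, hA, hne, hcount, hzero⟩ := hb
  obtain ⟨a, rfl⟩ := hcount.exists_eq_range hne
  choose φ hφI hφ0 hφ using fun n => (mem_carrier_iff hI).1 (hA ⟨n, rfl⟩)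
  refine eq_univ_of_forall fun x => mem_carrier_of_isFaithfulOn hI
    (φ := fun k => φ k.unpair.1 k.unpair.2) (fun k => hφI _ _) (fun k => hφ0 _ _)
    fun z hz _ h => ?_
  have hdisj : ∀ n, z ⊓ |a n| = 0 := fun n => by
    refine hφ n _ (le_inf hz (abs_nonneg _)) inf_le_right fun k => ?_
    have h1 := h (Nat.pair n k)
    simp only [Nat.unpair_pair] at h1
    exact le_antisymm ((dual_mono (hφ0 n k) inf_le_left).trans_eq h1)
      (dual_nonneg (hφ0 n k) (le_inf hz (abs_nonneg _)))
  by_contra hzne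
  obtain ⟨w, hw, hw0, hwne, hwz⟩ := exists_mem_nullCompl hE hI hsep hz hzne
  refine hwne (hzero.subset ⟨mem_carrier_of_mem_nullCompl hI hw0 hw, ?_⟩)
  rintro _ ⟨n, rfl⟩
  rw [abs_of_nonneg hw0]
  exact le_antisymm ((inf_le_inf_right _ hwz).trans_eq (hdisj n)) (le_inf hw0 (abs_nonneg _))

/-- Functionals taken from a countable base at zero are jointly faithful: a positive element killed
by all of them lies in every neighbourhood of zero, hence is zero by separation. -/
theorem carrier_eq_univ_of_metrizable (hI : IsIdealInOrderContDual I)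
    (hm : @TopologicalSpace.MetrizableSpace E (unboundedTopology (absWeakTopology I))) :
    carrier (unboundedTopology (absWeakTopology I)) = univ := by
  let t : TopologicalSpace E := unboundedTopology (absWeakTopology I)
  obtain ⟨V, hV⟩ := (𝓝 (0 : E)).exists_antitone_basis
  choose φ hφI hφ0 y hy ε hε hφV using
    fun n => (mem_nhds_unboundedTopology_iff hI).1 (hV.mem n)
  refine eq_univ_of_forall fun x => mem_carrier_of_isFaithfulOn hI hφI hφ0 fun z hz _ h => ?_
  by_contra hne
  obtain ⟨n, -, hn⟩ := hV.1.mem_iff.1 (isOpen_compl_singleton.mem_nhds (Ne.symm hne) : {z}ᶜ ∈ 𝓝 0)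
  refine hn (hφV n z ?_) rfl
  rw [abs_of_nonneg hz]
  exact ((dual_mono (hφ0 n) inf_le_left).trans_eq (h n)).trans_lt (hε n)

end Carrier

/-! ### From weak to absolute weak approximation -/

section ConvexSets

variable {E : Type u} [AddCommGroup E] [Lattice E] [IsOrderedAddMonoid E] [Module ℝ E]
  [IsOrderedModule ℝ E] {I : Submodule ℝ (orderDual E)}

/-- Points of the weak closure of a convex set can be approximated in the absolute weak
topology. -/
theorem exists_apply_abs_sub_lt (hI : IsIdealInOrderContDual I) {S : Set E} (hS : Convex ℝ S)
    {x : E} (hx : x ∈ closure[weakTopology I] S) {φ : orderDual E} (hφ : φ ∈ I) (h0 : 0 ≤ φ)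
    {ε : ℝ} (hε : 0 < ε) : ∃ s ∈ S, φ.1 |s - x| < ε := by
  by_contra! hcon
  -- Separate `S` from a ball of the one seminorm `z ↦ φ |z|`. The functional is bounded by a
  -- multiple of that seminorm, so it belongs to the ideal `I` and its half-spaces are weakly open.
  obtain ⟨f, u, C, hC, hfx, hfS⟩ : ∃ (f : E →ₗ[ℝ] ℝ) (u C : ℝ), (∀ z, |f z| ≤ C * φ.1 |z|) ∧
      f x < u ∧ ∀ s ∈ S, u ≤ f s := by
    let p : SeminormFamily ℝ E Unit := fun _ => absSeminorm φ
    let _ : TopologicalSpace E := p.moduleFilterBasis.topology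
    have hp : WithSeminorms p := ⟨rfl⟩
    have := hp.topologicalAddGroup
    have := hp.continuousSMul
    have hopen : IsOpen ((p ()).ball x ε) :=
      isOpen_lt ((hp.continuous_seminorm ()).comp (continuous_id.sub continuous_const))
        continuous_const
    obtain ⟨f, u, hf1, hf2⟩ := geometric_hahn_banach_open ((p ()).convex_ball x ε) hopen hS
      (Set.disjoint_left.2 fun z hz hzS => by
        rw [Seminorm.mem_ball] at hz
        change absSeminorm φ (z - x) < ε at hz
        rw [absSeminorm_apply_of_nonneg h0] at hz
        exact (hcon z hzS).not_gt hz)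
    obtain ⟨s, C, -, hC⟩ := Seminorm.bound_of_continuous hp
      ((normSeminorm ℝ ℝ).comp f.toLinearMap) (continuous_norm.comp f.continuous)
    refine ⟨f.toLinearMap, u, C, fun z => ?_, hf1 x (Seminorm.mem_ball_self _ hε), hf2⟩
    have h1 : s.sup p ≤ absSeminorm φ := Finset.sup_le fun _ _ => le_rfl
    calc |f z| ≤ C * (s.sup p) z := hC z
      _ ≤ C * absSeminorm φ z := mul_le_mul_of_nonneg_left (h1 z) C.2
      _ = C * φ.1 |z| := by rw [absSeminorm_apply_of_nonneg h0]
  have hbdd : f ∈ orderDual E := fun a b => by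
    refine ⟨|C| * φ.1 (|a| + |b|), fun z hz => (hC z).trans ?_⟩
    refine mul_le_mul (le_abs_self C) (dual_mono h0 (abs_le'.2 ⟨?_, ?_⟩))
      (dual_nonneg h0 (abs_nonneg z)) (abs_nonneg C)
    · exact (hz.2.trans (le_abs_self b)).trans (le_add_of_nonneg_left (abs_nonneg a))
    · exact ((neg_le_neg hz.1).trans (neg_le_abs a)).trans
        (le_add_of_nonneg_right (abs_nonneg b))
  have hfI : (⟨f, hbdd⟩ : orderDual E) ∈ I :=
    hI.mem_of_abs_apply_le (I.smul_mem C hφ) fun z => hC z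
  have hopen : IsOpen[weakTopology I] {z | f z < u} :=
    (iInf₂_le (⟨f, hbdd⟩ : orderDual E) hfI : weakTopology I ≤ _) _ ⟨Iio u, isOpen_Iio, rfl⟩
  obtain ⟨s, hs1, hs2⟩ := (@mem_closure_iff E (weakTopology I) x S).1 hx _ hopen hfx
  exact (hfS s hs2).not_gt hs1

end ConvexSets

/-! ### Unbounded order convergent sequences -/

section UnboundedOrderConvergence

variable {E : Type u} [AddCommGroup E] [Lattice E] [IsOrderedAddMonoid E]

/-- The eventual upper bounds themselves, in reversed order, form the dominating net; `y` makes its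
index set non-empty. -/
theorem OrderConverges.of_isGLB_upperBounds {t : ℕ → E} (ht : ∀ n, 0 ≤ t n)
    {y : E} (hy : ∀ n, t n ≤ y) (h : IsGLB {b | ∃ m, ∀ n, m ≤ n → t n ≤ b} 0) :
    OrderConverges t 0 := by
  let D : Set E := {b | ∃ m, ∀ n, m ≤ n → t n ≤ b}
  refine ⟨(D)ᵒᵈ, inferInstance, ⟨OrderDual.toDual ⟨y, 0, fun n _ => hy n⟩⟩, ⟨fun a b => ?_⟩,
    fun a => (OrderDual.ofDual (α := D) a).1, fun a b hab => hab, ?_, fun b => ?_⟩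
  · obtain ⟨m₁, h₁⟩ := (OrderDual.ofDual (α := D) a).2
    obtain ⟨m₂, h₂⟩ := (OrderDual.ofDual (α := D) b).2
    exact ⟨OrderDual.toDual (α := D) ⟨_ ⊓ _, max m₁ m₂, fun n hn =>
      le_inf (h₁ n ((le_max_left _ _).trans hn)) (h₂ n ((le_max_right _ _).trans hn))⟩,
      inf_le_left (α := E), inf_le_right (α := E)⟩
  · have : range (fun a : (D)ᵒᵈ => (OrderDual.ofDual (α := D) a).1) = D := Subtype.range_coe
    rwa [this]
  · obtain ⟨m, hm⟩ := (OrderDual.ofDual (α := D) b).2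
    refine ⟨m, fun n hn => ?_⟩
    rw [sub_zero, abs_of_nonneg (ht n)]
    exact hm n hn

/-- In an Archimedean vector lattice the gaps between an increasing sequence and its upper bounds
have infimum zero. -/
theorem IsArchimedean.isGLB_upperBounds_sub (hE : IsArchimedean E) {a : ℕ → E} {y : E}
    (hy : y ∈ upperBounds (range a)) :
    IsGLB {d | ∃ b ∈ upperBounds (range a), ∃ n, d = b - a n} 0 := by
  refine ⟨?_, fun c hc => ?_⟩
  · rintro _ ⟨b, hb, n, rfl⟩
    exact sub_nonneg.2 (hb ⟨n, rfl⟩)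
  -- A lower bound `c` of all gaps can be subtracted from any upper bound, leaving an upper bound.
  · have key : ∀ k : ℕ, y - k • c ∈ upperBounds (range a) := by
      intro k
      induction k with
      | zero => simpa using hy
      | succ k ih =>
        rintro _ ⟨n, rfl⟩
        rw [succ_nsmul, ← sub_sub]
        exact le_sub_comm.1 (hc ⟨_, ih, n, rfl⟩)
    exact hE c (y - a 0) (sub_nonneg.2 (hy ⟨0, rfl⟩)) fun k => le_sub_comm.1 (key k ⟨0, rfl⟩)

variable [Module ℝ E] [IsOrderedModule ℝ E]

/-- An element below all eventual upper bounds of `t n ⊓ y` is annihilated by `φ` if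
`φ (t n)` tends to zero geometrically. -/
theorem apply_eq_zero_of_le_upperBounds (hE : IsArchimedean E) {φ : orderDual E}
    (hφ : φ ∈ orderContDual E) (h0 : 0 ≤ φ) {t : ℕ → E} (ht : ∀ n, 0 ≤ t n) {y : E} {N : ℕ}
    (hN : ∀ n, N ≤ n → φ.1 (t n) ≤ (1 / 2 : ℝ) ^ n) {c : E} (hc0 : 0 ≤ c)
    (hc : c ∈ lowerBounds {b | ∃ m, ∀ n, m ≤ n → t n ⊓ y ≤ b}) : φ.1 c = 0 := by
  refine le_antisymm ?_ (dual_nonneg h0 hc0)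
  have key : ∀ m, N ≤ m → φ.1 c ≤ 2 * (1 / 2 : ℝ) ^ m := by
    intro m hm
    refine le_of_forall_pos_le_add fun δ hδ => ?_
    -- The supremum of the tail need not exist, so `c` is compared with an upper bound `b` of the
    -- partial suprema with `φ (b - a k) < δ`. The geometric series bounds `φ (a k)`.
    let a := partialSups fun i => t (m + i) ⊓ y
    have hub : y ∈ upperBounds (range a) := by
      rintro _ ⟨k, rfl⟩
      exact partialSups_le _ _ _ fun i _ => inf_le_right
    obtain ⟨_, ⟨b, hb, k, rfl⟩, hlt⟩ := exists_apply_lt hφ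
      (D := {d | ∃ b ∈ upperBounds (range a), ∃ n, d = b - a n}) ⟨_, y, hub, 0, rfl⟩
      (by
        rintro _ ⟨b₁, hb₁, k₁, rfl⟩ _ ⟨b₂, hb₂, k₂, rfl⟩
        exact ⟨_, ⟨b₁ ⊓ b₂, fun z hz => le_inf (hb₁ hz) (hb₂ hz), max k₁ k₂, rfl⟩,
          sub_le_sub inf_le_left (a.monotone (le_max_left _ _)),
          sub_le_sub inf_le_right (a.monotone (le_max_right _ _))⟩)
      (hE.isGLB_upperBounds_sub hub) hδ
    have h1 : c ≤ b := hc ⟨m, fun n hn => by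
      refine le_trans ?_ (hb ⟨n - m, rfl⟩)
      have := le_partialSups (fun i => t (m + i) ⊓ y) (n - m)
      simpa only [Nat.add_sub_cancel' hn] using this⟩
    have h2 : a k ≤ ∑ i ∈ Finset.range (k + 1), t (m + i) :=
      partialSups_le _ _ _ fun i hi => inf_le_left.trans
        (Finset.single_le_sum (f := fun i => t (m + i)) (fun j _ => ht _)
          (Finset.mem_range.2 (Nat.lt_succ_of_le hi)))
    have h3 : φ.1 (a k) ≤ 2 * (1 / 2 : ℝ) ^ m := by
      refine (dual_mono h0 h2).trans ?_
      rw [map_sum]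
      calc ∑ i ∈ Finset.range (k + 1), φ.1 (t (m + i))
          ≤ ∑ i ∈ Finset.range (k + 1), (1 / 2 : ℝ) ^ m * (1 / 2 : ℝ) ^ i :=
            Finset.sum_le_sum fun i _ => by
              rw [← pow_add]
              exact hN _ (hm.trans (Nat.le_add_right m i))
        _ = (1 / 2 : ℝ) ^ m * ∑ i ∈ Finset.range (k + 1), (1 / 2 : ℝ) ^ i :=
            (Finset.mul_sum _ _ _).symm
        _ ≤ (1 / 2 : ℝ) ^ m * 2 :=
            mul_le_mul_of_nonneg_left (sum_geometric_two_le _) (by positivity)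
        _ = 2 * (1 / 2 : ℝ) ^ m := mul_comm _ _
    have h4 := dual_mono h0 h1
    rw [map_sub] at hlt
    linarith
  have hlim : Tendsto (fun m : ℕ => 2 * (1 / 2 : ℝ) ^ m) atTop (𝓝 0) := by
    simpa using (tendsto_pow_atTop_nhds_zero_of_lt_one (r := (1 / 2 : ℝ))
      (by norm_num) (by norm_num)).const_mul 2
  refine ge_of_tendsto hlim ?_
  filter_upwards [eventually_ge_atTop N] with m hm using key m hm

/-- A positive sequence is uo-null if it tends to zero geometrically along countably many
positive order continuous functionals that are jointly faithful on each of its terms. -/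
theorem orderConverges_inf_of_isFaithfulOn (hE : IsArchimedean E) {t : ℕ → E} (ht : ∀ n, 0 ≤ t n)
    {φ : ℕ → ℕ → orderDual E} (hφ : ∀ m k, φ m k ∈ orderContDual E) (hφ0 : ∀ m k, 0 ≤ φ m k)
    (hfaith : ∀ m, IsFaithfulOn (φ m) (t m))
    (hlim : ∀ m k, ∃ N, ∀ n, N ≤ n → (φ m k).1 (t n) ≤ (1 / 2 : ℝ) ^ n) {y : E} (hy : 0 ≤ y) :
    OrderConverges (fun n => t n ⊓ y) 0 := by
  refine OrderConverges.of_isGLB_upperBounds (fun n => le_inf (ht n) hy) (fun n => inf_le_right)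
    ⟨?_, fun c hc => ?_⟩
  · rintro b ⟨m, hm⟩
    exact (le_inf (ht m) hy).trans (hm m le_rfl)
  have hd0 : 0 ≤ c ⊔ 0 := le_sup_right
  have hd : c ⊔ 0 ∈ lowerBounds {b | ∃ m, ∀ n, m ≤ n → t n ⊓ y ≤ b} := fun b hb =>
    sup_le (hc hb) (by obtain ⟨m, hm⟩ := hb; exact (le_inf (ht m) hy).trans (hm m le_rfl))
  have hdisj : ∀ m, t m ⊓ (c ⊔ 0) = 0 := fun m =>
    hfaith m _ (le_inf (ht m) hd0) inf_le_left fun k => by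
      obtain ⟨N, hN⟩ := hlim m k
      have h1 := apply_eq_zero_of_le_upperBounds hE (hφ m k) (hφ0 m k) ht hN hd0 hd
      exact le_antisymm ((dual_mono (hφ0 m k) inf_le_right).trans_eq h1)
        (dual_nonneg (hφ0 m k) (le_inf (ht m) hd0))
  -- Put `d = c ⊔ 0`. If `k • d ≤ y`, disjointness gives `t n ⊓ y + k • d ≤ y` for every `n`, so `y
  -- - k • d` is an upper bound and lies above `d`; hence `(k + 1) • d ≤ y`.
  refine le_sup_left.trans (hE (c ⊔ 0) y hy fun k => ?_)
  induction k with
  | zero => simpa using hy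
  | succ k ih =>
    rw [succ_nsmul']
    refine le_sub_iff_add_le.1 (hd ⟨0, fun n _ => le_sub_iff_add_le.2 ?_⟩)
    refine add_le_of_inf_eq_zero (le_antisymm ?_ (le_inf (le_inf (ht n) hy)
      (nsmul_nonneg hd0 k))) inf_le_right ih
    exact (inf_le_inf_right _ inf_le_left).trans_eq
      (inf_nsmul_eq_zero (ht n) hd0 (hdisj n) k)

theorem exists_seq_uoConverges (hE : IsArchimedean E) {I : Submodule ℝ (orderDual E)}
    (hI : IsIdealInOrderContDual I)
    (hC : carrier (unboundedTopology (absWeakTopology I)) = univ) {S : Set E} (hS : Convex ℝ S)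
    {x : E} (hx : x ∈ closure[weakTopology I] S) :
    ∃ s : ℕ → E, (∀ n, s n ∈ S) ∧ UOConverges s x := by
  choose φ hφI hφ0 hφ using fun z : E => (mem_carrier_iff hI).1 (hC ▸ mem_univ z)
  -- The functionals needed depend on the terms already chosen, so the choice is recursive. The
  -- second component of a pair is its precision level, setting both the error bound and how many
  -- functionals of each earlier term are controlled.
  obtain ⟨q, hqS, hq⟩ := exists_seq_of_forall_finset_exists (fun p : E × ℕ => p.1 ∈ S)
    (fun p q => p.2 < q.2 ∧ ∀ k ≤ q.2, (φ (p.1 - x) k).1 |q.1 - x| ≤ (1 / 2 : ℝ) ^ q.2)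
    fun F _ => by
      let N := F.sup Prod.snd + 1
      have hnn : ∀ p : E × ℕ, 0 ≤ ∑ k ∈ Finset.range (N + 1), φ (p.1 - x) k :=
        fun p => sum_dual_nonneg _ fun k _ => hφ0 _ k
      obtain ⟨s, hs, hlt⟩ := exists_apply_abs_sub_lt hI hS hx
        (φ := ∑ p ∈ F, ∑ k ∈ Finset.range (N + 1), φ (p.1 - x) k)
        (I.sum_mem fun p _ => I.sum_mem fun k _ => hφI _ k) (sum_dual_nonneg _ fun p _ => hnn p)
        (ε := (1 / 2 : ℝ) ^ N) (by positivity)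
      refine ⟨(s, N), hs, fun p hp => ⟨Nat.lt_succ_of_le (Finset.le_sup (f := Prod.snd) hp),
        fun k hk => le_trans ?_ hlt.le⟩⟩
      rw [sum_apply]
      refine le_trans ?_ (Finset.single_le_sum
        (f := fun p : E × ℕ => (∑ k ∈ Finset.range (N + 1), φ (p.1 - x) k).1 |s - x|)
        (fun p _ => dual_nonneg (hnn p) (abs_nonneg _)) hp)
      simp only [sum_apply]
      exact Finset.single_le_sum (f := fun k => (φ (p.1 - x) k).1 |s - x|)
        (fun k _ => dual_nonneg (hφ0 _ k) (abs_nonneg _))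
        (Finset.mem_range.2 (Nat.lt_succ_of_le hk))
  have hmono : StrictMono fun n => (q n).2 := fun m n hmn => (hq m n hmn).1
  refine ⟨fun n => (q n).1, hqS, fun y => ?_⟩
  refine orderConverges_inf_of_isFaithfulOn hE (fun n => abs_nonneg _)
    (φ := fun m => φ ((q m).1 - x)) (fun m k => hI.1 (hφI _ k)) (fun m k => hφ0 _ k)
    (fun m => hφ _) (fun m k => ⟨max (m + 1) k, fun n hn => ?_⟩) (abs_nonneg y)
  have hnq : n ≤ (q n).2 := hmono.le_apply
  refine ((hq m n ((le_max_left _ _).trans hn)).2 k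
    (((le_max_right _ _).trans hn).trans hnq)).trans ?_
  exact pow_le_pow_of_le_one (by norm_num) (by norm_num) hnq

end UnboundedOrderConvergence

end VectorLattice

theorem mainTheorem10 {E : Type*} [AddCommGroup E] [Lattice E] [IsOrderedAddMonoid E]
    [Module ℝ E] [IsOrderedModule ℝ E] (hE : VectorLattice.IsArchimedean E)
    (I : Submodule ℝ (VectorLattice.orderDual E))
    (hI : VectorLattice.IsIdealInOrderContDual I)
    (hsep : ∀ x y : E, x ≠ y → ∃ φ ∈ I, φ.1 x ≠ φ.1 y) :
    (VectorLattice.carrier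
        (VectorLattice.unboundedTopology (VectorLattice.absWeakTopology I)) = Set.univ ↔
      VectorLattice.CountableSupProperty E) ∧
    (VectorLattice.HasCountableOrderBasis
        (VectorLattice.carrier
          (VectorLattice.unboundedTopology (VectorLattice.absWeakTopology I))) →
      VectorLattice.carrier
        (VectorLattice.unboundedTopology (VectorLattice.absWeakTopology I)) = Set.univ) ∧
    (@TopologicalSpace.MetrizableSpace E
        (VectorLattice.unboundedTopology (VectorLattice.absWeakTopology I)) →
      VectorLattice.carrier
        (VectorLattice.unboundedTopology (VectorLattice.absWeakTopology I)) = Set.univ) ∧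
    (VectorLattice.CountableSupProperty E →
      ∀ S : Set E, Convex ℝ S → ∀ x ∈ closure[VectorLattice.weakTopology I] S,
        ∃ s : ℕ → E, (∀ n, s n ∈ S) ∧ VectorLattice.UOConverges s x) := by
  have hiff : VectorLattice.carrier
      (VectorLattice.unboundedTopology (VectorLattice.absWeakTopology I)) = Set.univ ↔
      VectorLattice.CountableSupProperty E :=
    ⟨VectorLattice.countableSup_of_carrier_eq_univ hI,
      VectorLattice.carrier_eq_univ_of_countableSup hE hI hsep⟩
  exact ⟨hiff, VectorLattice.carrier_eq_univ_of_hasCountableOrderBasis hE hI hsep,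
    VectorLattice.carrier_eq_univ_of_metrizable hI,
    fun hc _ hS _ hx => VectorLattice.exists_seq_uoConverges hE hI (hiff.2 hc) hS hx⟩
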